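/- Let $(K,v)$ be a valued field with valuation ring $\mathcal O_v$. For a valuation ring $\mathcal O$ of $K$, an $\mathcal O$-ideal is a nonzero $\mathcal O$-submodule $I\subsetneq K$ (so fractional ideals are included); it is principal if $I=a\mathcal O$ for some $a\in K$. For $\mathcal O_v$-ideals $I,I_1,I_2$ put $\mathcal O(I)=\{b\in K\mid bI\subseteq I\}$, which is a valuation ring of $K$ containing $\mathcal O_v$, and $I_2:I_1=\{a\in K\mid aI_1\subseteq I_2\}$. For an $\mathcal O_v$-ideal $J$, let $w$ be the (additively written) valuation of $K$ with valuation ring $\mathcal O(J)$ and $wJ=\{wb\mid 0\neq b\in J\}$; the deep closure of $J$ is $$\widehat{\widehat J}=\begin{cases} a\,\mathcal O(J) & \text{if there is } a\in K\setminus\{0\} \text{ such that } wa \text{ is the infimum of } wJ \text{ in the value group } wK,\\ J & \text{otherwise.}\end{cases}$$ Theorem. Let $I_1$ and $I_2$ be $\mathcal O_v$-ideals, and consider the condition $(*)$ $\mathcal O(I_1)\subseteq\mathcal O(I_2)$, and if $I_1$ is a nonprincipal $\mathcal O(I_2)$-ideal (that is, $I_1$ is an $\mathcal O(I_2)$-ideal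 and is not principal as such), then $I_2$ is a nonprincipal $\mathcal O(I_2)$-ideal. (a) If $(*)$ holds, then $J=I_2:I_1$ is the largest $\mathcal O_v$-ideal $J$ with $I_1J=I_2$, and it is equal to - $a^{-1}I_2$ if $I_1\mathcal O(I_2)=a\,\mathcal O(I_2)$ with $a\in K$, - the deep closure of $I_2(\mathcal O_v:I_1)$ if $I_1\mathcal O(I_2)$ is a nonprincipal $\mathcal O(I_2)$-ideal. (b) Condition $(*)$ fails if and only if one of the following holds: - (i) $\mathcal O(I_2)\subsetneq\mathcal O(I_1)$, or - (ii) $\mathcal O(I_1)=\mathcal O(I_2)$, and $I_1$ is a nonprincipal $\mathcal O(I_1)$-ideal, but $I_2$ is a principal $\mathcal O(I_1)$-ideal. (c) If $(*)$ fails, then there is no $\mathcal O_v$-ideal $J$ with $I_1J=I_2$. -/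

import Mathlib

open scoped Pointwise

namespace ValuationIdeals

variable {K : Type*} [Field K]

/-- The `O`-ideals in the sense used here, for a valuation ring `O` of `K`: the nonzero
`O`-submodules of `K` that are properly contained in `K` (so fractional ideals are included). -/
def IsOIdeal {O : ValuationSubring K} (I : Submodule O K) : Prop :=
  I ≠ ⊥ ∧ I ≠ ⊤

/-- The subset `S` of `K` is an `O`-ideal, and it is principal, that is, of the form `aO`. -/
def IsPrincipalOIdealOf (O : ValuationSubring K) (S : Set K) : Prop :=
  ∃ M : Submodule O K, (M : Set K) = S ∧ IsOIdeal M ∧ M.IsPrincipal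

/-- The subset `S` of `K` is an `O`-ideal, and it is not principal as an `O`-ideal. -/
def IsNonprincipalOIdealOf (O : ValuationSubring K) (S : Set K) : Prop :=
  ∃ M : Submodule O K, (M : Set K) = S ∧ IsOIdeal M ∧ ¬ M.IsPrincipal

/-- The invariance valuation ring `O(I) = {b ∈ K | bI ⊆ I}` of `I`. -/
def invRing {A : ValuationSubring K} (I : Submodule A K) : ValuationSubring K where
  carrier := {b | ∀ x ∈ I, b * x ∈ I}
  mul_mem' := fun {a b} ha hb x hx => by
    rw [mul_assoc]; exact ha _ (hb x hx)
  one_mem' := fun x hx => by rwa [one_mul]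
  add_mem' := fun {a b} ha hb x hx => by
    rw [add_mul]; exact I.add_mem (ha x hx) (hb x hx)
  zero_mem' := fun x _ => by rw [zero_mul]; exact I.zero_mem
  neg_mem' := fun {a} ha x hx => by
    rw [neg_mul]; exact I.neg_mem (ha x hx)
  mem_or_inv_mem' := fun a => by
    rcases A.mem_or_inv_mem a with h | h
    · exact Or.inl fun x hx => I.smul_mem (⟨a, h⟩ : A) hx
    · exact Or.inr fun x hx => I.smul_mem (⟨a⁻¹, h⟩ : A) hx

theorem mem_invRing {A : ValuationSubring K} {I : Submodule A K} {b : K} :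
    b ∈ invRing I ↔ ∀ x ∈ I, b * x ∈ I := Iff.rfl

theorem le_invRing {A : ValuationSubring K} (I : Submodule A K) : A ≤ invRing I :=
  fun a ha _ hx => I.smul_mem (⟨a, ha⟩ : A) hx

/-- `I`, viewed as a module over its invariance valuation ring `O(I)`. -/
def overInvRing {A : ValuationSubring K} (I : Submodule A K) : Submodule (invRing I) K where
  carrier := I
  add_mem' := I.add_mem
  zero_mem' := I.zero_mem
  smul_mem' := fun c x hx => c.2 x hx

/-- For an overring `O` of `A`, an `O`-submodule of `K` viewed as an `A`-submodule. -/
def restrictTo {A O : ValuationSubring K} (h : A ≤ O) (M : Submodule O K) : Submodule A K where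
  carrier := M
  add_mem' := M.add_mem
  zero_mem' := M.zero_mem
  smul_mem' := fun c _ hx => M.smul_mem (⟨c.1, h c.2⟩ : O) hx

/-- The product `I O` of an `A`-submodule `I` of `K` with a valuation ring `O` of `K`,
as an `O`-submodule of `K`. -/
def mulRing {A : ValuationSubring K} (I : Submodule A K) (O : ValuationSubring K) :
    Submodule O K :=
  Submodule.span O (I : Set K)

/-- With `w` the (additively written) valuation of `O`, the value `w a` of the nonzero element `a`
is the infimum of `wJ = {w b | 0 ≠ b ∈ J}` in the value group of `w`. Mathlib writes valuations
multiplicatively, which reverses the order, so that this infimum is a least upper bound; the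
additional element `0` of Mathlib's value group is no upper bound of `wJ` when `J ≠ 0`. -/
def IsInfValue {O : ValuationSubring K} (J : Submodule O K) (a : K) : Prop :=
  a ≠ 0 ∧ IsLUB (O.valuation '' {b : K | b ∈ J ∧ b ≠ 0}) (O.valuation a)

open Classical in
/-- The closure of `J` as an `O`-ideal: it is `aO` if there is `a ∈ K` such that `w a` is the
infimum of `wJ`, and `J` otherwise. By `closure_eq_of_isInfValue` below, it does not depend
on the choice of `a`. -/
noncomputable def closure {O : ValuationSubring K} (J : Submodule O K) : Submodule O K :=
  if h : ∃ a : K, IsInfValue J a then Submodule.span O {h.choose} else J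

theorem closure_eq_of_isInfValue {O : ValuationSubring K} {J : Submodule O K} {a : K}
    (ha : IsInfValue J a) : closure J = Submodule.span O {a} := by
  have h : ∃ a : K, IsInfValue J a := ⟨a, ha⟩
  have key : ∀ {x y : K}, y ≠ 0 → O.valuation x = O.valuation y →
      Submodule.span O {x} ≤ Submodule.span O {y} := by
    intro x y hy hxy
    have hm : x / y ∈ O := by
      rw [← ValuationSubring.valuation_le_one_iff, map_div₀, hxy, div_self]
      exact (Valuation.ne_zero_iff _).2 hy
    rw [Submodule.span_singleton_le_iff_mem, Submodule.mem_span_singleton]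
    exact ⟨⟨x / y, hm⟩, div_mul_cancel₀ x hy⟩
  have hv := h.choose_spec.2.unique ha.2
  rw [closure, dif_pos h]
  exact le_antisymm (key ha.1 hv) (key h.choose_spec.1 hv.symm)

/-- The deep closure of an `A`-ideal `J`: the closure of `J` as an `O(J)`-ideal. -/
noncomputable def deepClosure {A : ValuationSubring K} (J : Submodule A K) : Submodule A K :=
  restrictTo (le_invRing J) (closure (overInvRing J))

/-- The solvability condition: `O(I₁) ⊆ O(I₂)`, and `I₂` is a nonprincipal `O(I₂)`-ideal if `I₁` is
a nonprincipal `O(I₂)`-ideal. -/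
def SolvCond {A : ValuationSubring K} (I₁ I₂ : Submodule A K) : Prop :=
  invRing I₁ ≤ invRing I₂ ∧
    (IsNonprincipalOIdealOf (invRing I₂) (I₁ : Set K) →
      IsNonprincipalOIdealOf (invRing I₂) (I₂ : Set K))

/-- The set of all `A`-ideals `J` with `I₁ J = I₂`. -/
def solutions {A : ValuationSubring K} (I₁ I₂ : Submodule A K) : Set (Submodule A K) :=
  {J | IsOIdeal J ∧ I₁ * J = I₂}

end ValuationIdeals

/-!
Everything rests on the fact that the `A`-submodules of `K` form a chain: if `x ∉ I` and `y ∈ I`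
then `y / x ∈ A`, and every element of a product `I * J` is a single product `i * j`.

Write `O = O(I₂)`. Say that `I₁` has no generator over `O` if no nonzero `z ∈ I₁` satisfies
`I₁ ⊆ z O` (`HasNoGenerator`). There are two cases.

* Some `z ∈ I₁` has `I₁ ⊆ z O`. Then `x = z * (x / z)` with `x / z ∈ I₂ : I₁` for each `x ∈ I₂`.
* `I₁` has no generator over `O`. Then `I₁` is automatically an `O`-module, so `(*)` forces
  `O(I₁) = O` and makes `I₂` nonprincipal over `O`. For `0 ≠ x ∈ I₂` choose `b ∉ O` with
  `b x ∈ I₂`, and, since `b ∉ O(I₁)`, some `z ∈ I₁` with `b z ∉ I₁`. Then `I₁ ⊆ b z A`, and the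
  factorization `x = z * (b x * (b z)⁻¹)` shows `I₁ * N = I₂` already for the smaller ideal
  `N = I₂ (A : I₁)` (`le_mul_mul_one_div`).

In both cases `I₁ (I₂ : I₁) = I₂`. In the second one, `I₁ N = I₂` also gives `O(N) = O`; moreover
every `x ∈ I₂ : I₁` lies in each `c O` that contains `N`, and an infimum `a` of the values of `N`
lies in `I₂ : I₁`, as otherwise the missing generator of `I₁` would produce a smaller
`c O ⊇ N`. This identifies `I₂ : I₁` with the deep closure of `N` (`div_eq_deepClosure`).

If `I₁ J = I₂` then `O(I₁) ⊆ O(I₂)`; and if `I₂ = a O`, then `a = i * j` with `i ∈ I₁`, `j ∈ J`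
makes `i` a generator of `I₁`. Hence no solution exists when `(*)` fails.
-/

namespace ValuationIdeals

variable {K : Type*} [Field K] {A : ValuationSubring K}

/-! ### The chain of submodules -/

theorem div_mem_of_notMem {O : ValuationSubring K} {I : Submodule A K} (hO : O ≤ invRing I)
    {x y : K} (hx : x ∉ I) (hy : y ∈ I) : y / x ∈ O := by
  rcases O.mem_or_inv_mem (y / x) with h | h
  · exact h
  · rcases eq_or_ne y 0 with rfl | hy0
    · rw [zero_div]; exact O.zero_mem
    · refine absurd ?_ hx
      have := hO h y hy
      rwa [inv_div, div_mul_cancel₀ x hy0] at this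

/-- Over a valuation ring, a product of two submodules consists of single products. -/
theorem exists_mul_eq_of_mem_mul {I J : Submodule A K} {x : K} (hx : x ∈ I * J) :
    ∃ i ∈ I, ∃ j ∈ J, i * j = x := by
  induction hx using Submodule.mul_induction_on' with
  | mem_mul_mem i hi j hj => exact ⟨i, hi, j, hj, rfl⟩
  | add x _ y _ hx hy =>
    -- the summand of smaller value absorbs the other one
    have key : ∀ u w : K, u / w ∈ A → w ≠ 0 → (∃ i ∈ I, ∃ j ∈ J, i * j = w) →
        ∃ i ∈ I, ∃ j ∈ J, i * j = u + w := by
      rintro u w huw hw ⟨i, hi, j, hj, rfl⟩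
      refine ⟨(u / (i * j) + 1) * i, I.smul_mem (⟨_, A.add_mem _ _ huw A.one_mem⟩ : A) hi,
        j, hj, ?_⟩
      rw [mul_assoc, add_mul, one_mul, div_mul_cancel₀ _ hw]
    rcases eq_or_ne x 0 with rfl | hx0
    · simpa using hy
    rcases eq_or_ne y 0 with rfl | hy0
    · simpa using hx
    rcases A.mem_or_inv_mem (x / y) with h | h
    · exact key x y h hy0 hy
    · rw [add_comm]
      exact key y x (by rwa [inv_div] at h) hx0 hx

theorem invRing_total (I J : Submodule A K) : invRing I ≤ invRing J ∨ invRing J ≤ invRing I := by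
  by_contra! h
  obtain ⟨h₁, h₂⟩ := h
  obtain ⟨b, hb, hb'⟩ := SetLike.not_le_iff_exists.1 h₁
  obtain ⟨c, hc, hc'⟩ := SetLike.not_le_iff_exists.1 h₂
  have hb0 : b ≠ 0 := fun h => hb' (h ▸ (invRing J).zero_mem)
  have hc0 : c ≠ 0 := fun h => hc' (h ▸ (invRing I).zero_mem)
  rcases A.mem_or_inv_mem (b / c) with h | h
  · refine hb' ?_
    rw [← div_mul_cancel₀ b hc0]
    exact (invRing J).mul_mem _ _ (le_invRing J h) hc
  · refine hc' ?_
    rw [← div_mul_cancel₀ c hb0, ← inv_div]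
    exact (invRing I).mul_mem _ _ (le_invRing I h) hb

theorem exists_mem_ne_zero {I : Submodule A K} (hI : I ≠ ⊥) : ∃ x ∈ I, x ≠ 0 :=
  I.ne_bot_iff.1 hI

theorem one_div_mul_le (I : Submodule A K) : I * (1 / I) ≤ 1 :=
  Submodule.mul_one_div_le_one

/-! ### Principal and nonprincipal ideals over overrings -/

/-- The submodule `I` is contained in no `z O` with `0 ≠ z ∈ I`: each such `z` has a multiple `b z`
in `I` with `b ∉ O`. For a nonzero `O`-module this means that it is not principal
(`isNonprincipalOIdealOf_iff`), but `I` is not assumed to be an `O`-module. -/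
def HasNoGenerator (O : ValuationSubring K) (I : Submodule A K) : Prop :=
  ∀ z ∈ I, z ≠ 0 → ∃ b ∉ O, b * z ∈ I

theorem not_hasNoGenerator_iff {O : ValuationSubring K} {I : Submodule A K} :
    ¬ HasNoGenerator O I ↔ ∃ z ∈ I, z ≠ 0 ∧ ∀ y ∈ I, y / z ∈ O := by
  constructor
  · intro h
    simp only [HasNoGenerator] at h
    push Not at h
    obtain ⟨z, hz, hz0, h⟩ := h
    refine ⟨z, hz, hz0, fun y hy => ?_⟩
    by_contra hyz
    exact h _ hyz (by rwa [div_mul_cancel₀ y hz0])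
  · rintro ⟨z, hz, hz0, h⟩ hn
    obtain ⟨b, hb, hbz⟩ := hn z hz hz0
    exact hb (by simpa [hz0] using h _ hbz)

/-- A submodule without generator over an overring `O` of `A` is an `O`-module. -/
theorem HasNoGenerator.le_invRing {O : ValuationSubring K} (hAO : A ≤ O) {I : Submodule A K}
    (h : HasNoGenerator O I) : O ≤ invRing I := by
  intro c hc z hz
  rcases eq_or_ne z 0 with rfl | hz0
  · simp
  obtain ⟨b, hb, hbz⟩ := h z hz hz0
  have hb0 : b ≠ 0 := fun h => hb (h ▸ O.zero_mem)
  have hcb : c / b ∈ A := by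
    rcases A.mem_or_inv_mem (c / b) with h | h
    · exact h
    · rcases eq_or_ne c 0 with rfl | hc0
      · simp
      · refine absurd ?_ hb
        rw [← div_mul_cancel₀ b hc0, ← inv_div]
        exact O.mul_mem _ _ (hAO h) hc
  have := I.smul_mem (⟨c / b, hcb⟩ : A) hbz
  rw [← div_mul_cancel₀ c hb0, mul_assoc]
  exact this

/-- An `A`-submodule that is stable under `O`, viewed as an `O`-submodule. -/
def extendTo {O : ValuationSubring K} (I : Submodule A K) (hO : O ≤ invRing I) :
    Submodule O K where
  carrier := I
  add_mem' := I.add_mem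
  zero_mem' := I.zero_mem
  smul_mem' := fun c x hx => hO c.2 x hx

theorem isOIdeal_of_coe_eq {O : ValuationSubring K} {I : Submodule A K} (hI : IsOIdeal I)
    {M : Submodule O K} (hM : (M : Set K) = I) : IsOIdeal M := by
  refine ⟨fun h => hI.1 ?_, fun h => hI.2 ?_⟩
  · exact SetLike.coe_injective (by rw [← hM, h]; rfl)
  · exact SetLike.coe_injective (by rw [← hM, h]; rfl)

theorem isPrincipal_iff_not_hasNoGenerator {O : ValuationSubring K} {I : Submodule A K}
    (hI : IsOIdeal I) {M : Submodule O K} (hM : (M : Set K) = I) :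
    M.IsPrincipal ↔ ¬ HasNoGenerator O I := by
  have hmem : ∀ x, x ∈ M ↔ x ∈ I := fun x => Set.ext_iff.1 hM x
  rw [not_hasNoGenerator_iff]
  constructor
  · rintro ⟨a, ha⟩
    have haM : a ∈ M := ha ▸ Submodule.mem_span_singleton_self a
    have ha0 : a ≠ 0 := by
      rintro rfl
      exact (isOIdeal_of_coe_eq hI hM).1 (by rw [ha, Submodule.span_zero_singleton])
    refine ⟨a, (hmem a).1 haM, ha0, fun y hy => ?_⟩
    rw [← hmem, ha, Submodule.mem_span_singleton] at hy
    obtain ⟨c, rfl⟩ := hy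
    have : c • a / a = (c : K) := mul_div_cancel_right₀ (c : K) ha0
    rw [this]
    exact c.2
  · rintro ⟨z, hz, hz0, h⟩
    refine ⟨z, le_antisymm (fun y hy => ?_) ?_⟩
    · exact Submodule.mem_span_singleton.2
        ⟨⟨y / z, h y ((hmem y).1 hy)⟩, div_mul_cancel₀ y hz0⟩
    · rw [Submodule.span_singleton_le_iff_mem, hmem]
      exact hz

theorem le_invRing_of_coe_eq {O : ValuationSubring K} {I : Submodule A K} {M : Submodule O K}
    (hM : (M : Set K) = I) : O ≤ invRing I := by
  have hmem : ∀ x, x ∈ M ↔ x ∈ I := fun x => Set.ext_iff.1 hM x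
  exact fun c hc x hx => (hmem _).1 (M.smul_mem (⟨c, hc⟩ : O) ((hmem x).2 hx))

theorem isNonprincipalOIdealOf_iff {O : ValuationSubring K} {I : Submodule A K}
    (hI : IsOIdeal I) :
    IsNonprincipalOIdealOf O (I : Set K) ↔ O ≤ invRing I ∧ HasNoGenerator O I := by
  constructor
  · rintro ⟨M, hM, -, hp⟩
    exact ⟨le_invRing_of_coe_eq hM,
      by_contra fun h => hp ((isPrincipal_iff_not_hasNoGenerator hI hM).2 h)⟩
  · rintro ⟨hO, h⟩
    have hM : (extendTo I hO : Set K) = I := rfl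
    exact ⟨_, hM, isOIdeal_of_coe_eq hI hM,
      fun hp => (isPrincipal_iff_not_hasNoGenerator hI hM).1 hp h⟩

theorem isPrincipalOIdealOf_iff {O : ValuationSubring K} {I : Submodule A K}
    (hI : IsOIdeal I) :
    IsPrincipalOIdealOf O (I : Set K) ↔ O ≤ invRing I ∧ ¬ HasNoGenerator O I := by
  constructor
  · rintro ⟨M, hM, -, hp⟩
    exact ⟨le_invRing_of_coe_eq hM, (isPrincipal_iff_not_hasNoGenerator hI hM).1 hp⟩
  · rintro ⟨hO, h⟩
    have hM : (extendTo I hO : Set K) = I := rfl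
    exact ⟨_, hM, isOIdeal_of_coe_eq hI hM, (isPrincipal_iff_not_hasNoGenerator hI hM).2 h⟩

theorem solvCond_iff {I₁ I₂ : Submodule A K} (hI₁ : IsOIdeal I₁) (hI₂ : IsOIdeal I₂) :
    SolvCond I₁ I₂ ↔ invRing I₁ ≤ invRing I₂ ∧
      (HasNoGenerator (invRing I₂) I₁ → HasNoGenerator (invRing I₂) I₂) := by
  rw [SolvCond, isNonprincipalOIdealOf_iff hI₁, isNonprincipalOIdealOf_iff hI₂]
  refine and_congr_right fun _ => ⟨fun h hn => ?_, fun h hn => ⟨le_rfl, h hn.2⟩⟩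
  exact (h ⟨hn.le_invRing (ValuationIdeals.le_invRing I₂), hn⟩).2

/-- If `I` has a generator over `O`, then the `O`-module `I O` is principal. -/
theorem hasNoGenerator_of_isNonprincipalOIdealOf_mulRing {O : ValuationSubring K}
    {I : Submodule A K} (h : IsNonprincipalOIdealOf O (mulRing I O : Set K)) :
    HasNoGenerator O I := by
  by_contra hn
  obtain ⟨z, hz, hz0, hI⟩ := not_hasNoGenerator_iff.1 hn
  obtain ⟨M, hM, -, hp⟩ := h
  obtain rfl := SetLike.coe_injective hM
  refine hp ⟨z, le_antisymm (Submodule.span_le.2 fun y hy => ?_) ?_⟩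
  · exact Submodule.mem_span_singleton.2 ⟨⟨y / z, hI y hy⟩, div_mul_cancel₀ y hz0⟩
  · rw [Submodule.span_singleton_le_iff_mem]
    exact Submodule.subset_span hz

/-! ### The quotient as a solution -/

theorem mul_div_le (I₁ I₂ : Submodule A K) : I₁ * (I₂ / I₁) ≤ I₂ := by
  rw [mul_comm]
  exact Submodule.le_div_iff_mul_le.1 le_rfl

theorem mul_mul_one_div_le (I₁ I₂ : Submodule A K) : I₁ * (I₂ * (1 / I₁)) ≤ I₂ := by
  rw [mul_left_comm]
  exact (mul_le_mul_right (one_div_mul_le I₁) I₂).trans (mul_one I₂).le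

/-- The inclusion `I₂ ⊆ I₁ (I₂ (A : I₁))`, which holds if `I₂` has no generator over some
overring of `O(I₁)`. -/
theorem le_mul_mul_one_div {O : ValuationSubring K} {I₁ I₂ : Submodule A K}
    (hO : invRing I₁ ≤ O) (h : HasNoGenerator O I₂) : I₂ ≤ I₁ * (I₂ * (1 / I₁)) := by
  intro x hx
  rcases eq_or_ne x 0 with rfl | hx0
  · exact Submodule.zero_mem _
  obtain ⟨b, hb, hbx⟩ := h x hx hx0
  have hb0 : b ≠ 0 := fun h => hb (h ▸ O.zero_mem)
  have hb₁ : ¬ ∀ z ∈ I₁, b * z ∈ I₁ := fun h => hb (hO h)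
  push Not at hb₁
  obtain ⟨z, hz, hbz⟩ := hb₁
  have hz0 : z ≠ 0 := by rintro rfl; simp at hbz
  have hd : (b * z)⁻¹ ∈ 1 / I₁ := by
    rw [Submodule.mem_div_iff_forall_mul_mem]
    intro y hy
    have := div_mem_of_notMem (le_invRing I₁) hbz hy
    rw [Submodule.mem_one]
    exact ⟨⟨_, this⟩, (div_eq_mul_inv y (b * z)).trans (mul_comm _ _)⟩
  have := Submodule.mul_mem_mul hz (Submodule.mul_mem_mul hbx hd)
  convert this using 1
  field_simp

/-- If `I₁ ⊆ z O(I₂)` with `0 ≠ z ∈ I₁`, then `z⁻¹ I₂ ⊆ I₂ : I₁`. -/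
theorem le_mul_div_of_not_hasNoGenerator {I₁ I₂ : Submodule A K}
    (h : ¬ HasNoGenerator (invRing I₂) I₁) : I₂ ≤ I₁ * (I₂ / I₁) := by
  obtain ⟨z, hz, hz0, hI⟩ := not_hasNoGenerator_iff.1 h
  intro x hx
  have hd : x / z ∈ I₂ / I₁ := by
    rw [Submodule.mem_div_iff_forall_mul_mem]
    intro y hy
    have := hI y hy x hx
    rwa [div_mul_eq_mul_div, mul_comm y x, ← div_mul_eq_mul_div] at this
  simpa [mul_div_cancel₀, hz0] using Submodule.mul_mem_mul hz hd

theorem mul_div_eq {I₁ I₂ : Submodule A K} (hI₁ : IsOIdeal I₁) (hI₂ : IsOIdeal I₂)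
    (h : SolvCond I₁ I₂) : I₁ * (I₂ / I₁) = I₂ := by
  rw [solvCond_iff hI₁ hI₂] at h
  refine le_antisymm (mul_div_le I₁ I₂) ?_
  by_cases hn : HasNoGenerator (invRing I₂) I₁
  · refine (le_mul_mul_one_div h.1 (h.2 hn)).trans (mul_le_mul_right ?_ I₁)
    rw [Submodule.le_div_iff_mul_le, mul_comm]
    exact mul_mul_one_div_le I₁ I₂
  · exact le_mul_div_of_not_hasNoGenerator hn

theorem isGreatest_div {I₁ I₂ : Submodule A K} (hI₁ : IsOIdeal I₁) (hI₂ : IsOIdeal I₂)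
    (h : SolvCond I₁ I₂) : IsGreatest (solutions I₁ I₂) (I₂ / I₁) := by
  have he := mul_div_eq hI₁ hI₂ h
  refine ⟨⟨⟨fun h0 => hI₂.1 ?_, fun h1 => hI₂.2 ?_⟩, he⟩, fun J hJ => ?_⟩
  · rw [← he, h0, Submodule.mul_bot]
  · obtain ⟨z, hz, hz0⟩ := exists_mem_ne_zero hI₁.1
    refine eq_top_iff.2 fun x _ => ?_
    have hx : x / z ∈ I₂ / I₁ := h1 ▸ Submodule.mem_top
    simpa [div_mul_cancel₀, hz0] using Submodule.mem_div_iff_forall_mul_mem.1 hx z hz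
  · rw [Submodule.le_div_iff_mul_le, mul_comm, hJ.2]

theorem div_eq_inv_smul {I₁ I₂ : Submodule A K} (hI₁ : IsOIdeal I₁) {a : K}
    (h : mulRing I₁ (invRing I₂) = Submodule.span (invRing I₂) {a}) :
    I₂ / I₁ = a⁻¹ • I₂ := by
  have hsub : ∀ y ∈ I₁, ∃ c ∈ invRing I₂, c * a = y := by
    intro y hy
    have hy' : y ∈ mulRing I₁ (invRing I₂) := Submodule.subset_span hy
    rw [h, Submodule.mem_span_singleton] at hy'
    obtain ⟨c, hc⟩ := hy'
    exact ⟨c, c.2, hc⟩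
  have ha0 : a ≠ 0 := by
    rintro rfl
    obtain ⟨z, hz, hz0⟩ := exists_mem_ne_zero hI₁.1
    obtain ⟨c, -, rfl⟩ := hsub z hz
    simp at hz0
  have ha : a ∈ Submodule.span (invRing I₂) (I₁ : Set K) := by
    change a ∈ mulRing I₁ (invRing I₂)
    rw [h]
    exact Submodule.mem_span_singleton_self a
  ext x
  rw [Submodule.mem_div_iff_forall_mul_mem, Submodule.mem_smul_pointwise_iff_exists]
  constructor
  · intro hx
    refine ⟨x * a, ?_, by rw [smul_eq_mul]; field_simp⟩
    clear h hsub ha0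
    induction ha using Submodule.span_induction with
    | mem y hy => exact hx y hy
    | zero => simp
    | add y z _ _ hy hz => rw [mul_add]; exact I₂.add_mem hy hz
    | smul c y _ hy =>
      have : x * c • y = (c : K) * (x * y) := mul_left_comm x (c : K) y
      rw [this]
      exact c.2 _ hy
  · rintro ⟨y, hy, rfl⟩ z hz
    obtain ⟨c, hc, rfl⟩ := hsub z hz
    have := hc y hy
    rw [smul_eq_mul]
    convert this using 1
    field_simp

/-! ### The deep closure -/

/-- Divisibility form of `IsInfValue`: `a O` is the least principal `O`-module containing `J`. -/
theorem isInfValue_iff {O : ValuationSubring K} {J : Submodule O K} (hJ : J ≠ ⊥) {a : K} :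
    IsInfValue J a ↔ a ≠ 0 ∧ (∀ y ∈ J, y / a ∈ O) ∧
      ∀ c, c ≠ 0 → (∀ y ∈ J, y / c ∈ O) → a / c ∈ O := by
  have hle : ∀ x y : K, y ≠ 0 → (O.valuation x ≤ O.valuation y ↔ x / y ∈ O) := by
    intro x y hy
    have hy' : 0 < O.valuation y := zero_lt_iff.2 ((Valuation.ne_zero_iff _).2 hy)
    rw [← ValuationSubring.valuation_le_one_iff, map_div₀, div_le_one₀ hy']
  have hub : ∀ c : K, c ≠ 0 →
      (O.valuation c ∈ upperBounds (O.valuation '' {b : K | b ∈ J ∧ b ≠ 0}) ↔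
        ∀ y ∈ J, y / c ∈ O) := by
    intro c hc
    rw [mem_upperBounds, Set.forall_mem_image]
    constructor
    · intro h y hy
      rcases eq_or_ne y 0 with rfl | hy0
      · simp
      · exact (hle y c hc).1 (h ⟨hy, hy0⟩)
    · exact fun h y hy => (hle y c hc).2 (h y hy.1)
  refine and_congr_right fun ha => ?_
  rw [IsLUB, IsLeast, hub a ha]
  refine and_congr_right fun _ => ?_
  constructor
  · exact fun h c hc hJc => (hle a c hc).1 (h ((hub c hc).2 hJc))
  · intro h g hg
    obtain ⟨c, rfl⟩ := O.valuation_surjective g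
    rcases eq_or_ne c 0 with rfl | hc
    -- the value zero bounds no nonzero element of `J`
    · obtain ⟨y, hy, hy0⟩ := J.ne_bot_iff.1 hJ
      have := hg (Set.mem_image_of_mem _ ⟨hy, hy0⟩)
      rw [map_zero, le_zero_iff, map_eq_zero] at this
      exact absurd this hy0
    · exact (hle a c hc).2 (h c hc ((hub c hc).1 hg))

theorem invRing_mul_one_div {I₁ I₂ : Submodule A K} (h : I₂ = I₁ * (I₂ * (1 / I₁))) :
    invRing (I₂ * (1 / I₁)) = invRing I₂ := by
  refine le_antisymm (fun b hb x hx => ?_) (fun b hb x hx => ?_)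
  · rw [h] at hx
    obtain ⟨i, hi, n, hn, rfl⟩ := exists_mul_eq_of_mem_mul hx
    rw [h, mul_left_comm b i n]
    exact Submodule.mul_mem_mul hi (hb n hn)
  · obtain ⟨i, hi, j, hj, rfl⟩ := exists_mul_eq_of_mem_mul hx
    rw [← mul_assoc]
    exact Submodule.mul_mem_mul (hb i hi) hj

/-- If `I₁ N = I₂` and `N ⊆ c O(I₂)`, then also `I₂ : I₁ ⊆ c O(I₂)`. -/
theorem div_mem_invRing_of_mul_eq {I₁ I₂ N : Submodule A K} (hN : I₁ * N = I₂) {c : K}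
    (hc0 : c ≠ 0) (hc : ∀ y ∈ N, y / c ∈ invRing I₂) {x : K} (hx : x ∈ I₂ / I₁) :
    x / c ∈ invRing I₂ := by
  intro u hu
  rw [← hN] at hu
  obtain ⟨i, hi, n, hn, rfl⟩ := exists_mul_eq_of_mem_mul hu
  have := hc n hn _ (Submodule.mem_div_iff_forall_mul_mem.1 hx i hi)
  convert this using 1
  field_simp

/-- If `I₁ N ⊆ I₂`, then an infimum `a` of the values of `N` lies in `I₂ : I₁`: otherwise
`a z ∉ I₂` for some `z ∈ I₁`, and with `b ∉ O(I₂)`, `b z ∈ I₁`, also `b⁻¹ a` would bound `N`. -/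
theorem mem_div_of_isLeast {I₁ I₂ N : Submodule A K} (h : HasNoGenerator (invRing I₂) I₁)
    (hN : I₁ * N ≤ I₂) {a : K} (ha0 : a ≠ 0)
    (ha : ∀ c, c ≠ 0 → (∀ y ∈ N, y / c ∈ invRing I₂) → a / c ∈ invRing I₂) :
    a ∈ I₂ / I₁ := by
  rw [Submodule.mem_div_iff_forall_mul_mem]
  by_contra! hcon
  obtain ⟨z, hz, haz⟩ := hcon
  have hz0 : z ≠ 0 := by rintro rfl; simp at haz
  obtain ⟨b, hb, hbz⟩ := h z hz hz0
  have hb0 : b ≠ 0 := fun h => hb (h ▸ (invRing I₂).zero_mem)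
  have key : a / (b⁻¹ * a) ∈ invRing I₂ := by
    refine ha (b⁻¹ * a) (mul_ne_zero (inv_ne_zero hb0) ha0) fun y hy => ?_
    have := div_mem_of_notMem le_rfl haz (hN (Submodule.mul_mem_mul hbz hy))
    convert this using 1
    field_simp
  refine hb ?_
  convert key using 1
  field_simp

theorem div_eq_deepClosure {I₁ I₂ : Submodule A K} (hI₂ : IsOIdeal I₂)
    (hO : invRing I₁ ≤ invRing I₂) (h₁ : HasNoGenerator (invRing I₂) I₁)
    (h₂ : HasNoGenerator (invRing I₂) I₂) : I₂ / I₁ = deepClosure (I₂ * (1 / I₁)) := by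
  have hmul : I₁ * (I₂ * (1 / I₁)) = I₂ :=
    le_antisymm (mul_mul_one_div_le I₁ I₂) (le_mul_mul_one_div hO h₂)
  have hinv := invRing_mul_one_div hmul.symm
  set N := I₂ * (1 / I₁) with hNdef
  have hmem : ∀ b, b ∈ invRing N ↔ b ∈ invRing I₂ := fun b => by rw [hinv]
  have hNJ : N ≤ I₂ / I₁ := by
    rw [Submodule.le_div_iff_mul_le, mul_comm, hmul]
  have hN0 : overInvRing N ≠ ⊥ := by
    intro h0
    refine hI₂.1 ?_
    have hN : N = ⊥ := by
      ext x
      exact SetLike.ext_iff.1 h0 x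
    rw [← hmul, hN, Submodule.mul_bot]
  have hinf : ∀ a, IsInfValue (overInvRing N) a ↔ a ≠ 0 ∧ (∀ y ∈ N, y / a ∈ invRing I₂) ∧
      ∀ c, c ≠ 0 → (∀ y ∈ N, y / c ∈ invRing I₂) → a / c ∈ invRing I₂ := by
    intro a
    rw [isInfValue_iff hN0]
    simp only [hmem]
    rfl
  ext x
  change x ∈ I₂ / I₁ ↔ x ∈ closure (overInvRing N)
  by_cases hex : ∃ a, IsInfValue (overInvRing N) a
  · obtain ⟨a, ha⟩ := hex
    rw [closure_eq_of_isInfValue ha, Submodule.mem_span_singleton]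
    obtain ⟨ha0, haN, hal⟩ := (hinf a).1 ha
    constructor
    · intro hx
      exact ⟨⟨x / a, (hmem _).2 (div_mem_invRing_of_mul_eq hmul ha0 haN hx)⟩,
        div_mul_cancel₀ x ha0⟩
    · rintro ⟨c, rfl⟩
      have haJ := mem_div_of_isLeast h₁ hmul.le ha0 hal
      rw [Submodule.mem_div_iff_forall_mul_mem] at haJ ⊢
      intro y hy
      have : c • a * y = (c : K) * (a * y) := mul_assoc (c : K) a y
      rw [this]
      exact (hmem _).1 c.2 _ (haJ y hy)
  · rw [closure, dif_neg hex]
    change x ∈ I₂ / I₁ ↔ x ∈ N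
    refine ⟨fun hx => ?_, fun hx => hNJ hx⟩
    -- an element of `I₂ : I₁` outside `N` would have the infimum of the values of `N` as value
    by_contra hxN
    have hx0 : x ≠ 0 := by rintro rfl; exact hxN N.zero_mem
    exact hex ⟨x, (hinf x).2 ⟨hx0, fun y hy => div_mem_of_notMem hinv.ge hxN hy,
      fun c hc0 hc => div_mem_invRing_of_mul_eq hmul hc0 hc hx⟩⟩

/-! ### Failure of the solvability condition -/

theorem not_solvCond_iff {I₁ I₂ : Submodule A K} (hI₁ : IsOIdeal I₁) (hI₂ : IsOIdeal I₂) :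
    ¬ SolvCond I₁ I₂ ↔ invRing I₂ < invRing I₁ ∨
      (invRing I₁ = invRing I₂ ∧ IsNonprincipalOIdealOf (invRing I₁) (I₁ : Set K) ∧
        IsPrincipalOIdealOf (invRing I₁) (I₂ : Set K)) := by
  rw [solvCond_iff hI₁ hI₂, isNonprincipalOIdealOf_iff hI₁, isPrincipalOIdealOf_iff hI₂]
  constructor
  · intro h
    by_cases hle : invRing I₁ ≤ invRing I₂
    · have h' : ¬ (HasNoGenerator (invRing I₂) I₁ → HasNoGenerator (invRing I₂) I₂) :=
        fun h' => h ⟨hle, h'⟩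
      push Not at h'
      have heq := le_antisymm hle (h'.1.le_invRing (le_invRing I₂))
      refine Or.inr ⟨heq, ⟨le_rfl, ?_⟩, hle, ?_⟩
      · rw [heq]; exact h'.1
      · rw [heq]; exact h'.2
    · exact Or.inl (lt_of_le_not_ge ((invRing_total I₁ I₂).resolve_left hle) hle)
  · rintro (h | ⟨heq, h₁, h₂⟩) hs
    · exact absurd hs.1 h.not_ge
    · rw [heq] at h₁ h₂
      exact h₂.2 (hs.2 h₁.2)

theorem solvCond_of_mul_eq {I₁ I₂ J : Submodule A K} (hI₁ : IsOIdeal I₁) (hI₂ : IsOIdeal I₂)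
    (hJ : I₁ * J = I₂) : SolvCond I₁ I₂ := by
  rw [solvCond_iff hI₁ hI₂]
  refine ⟨fun b hb x hx => ?_, fun h₁ => ?_⟩
  · rw [← hJ] at hx ⊢
    obtain ⟨i, hi, j, hj, rfl⟩ := exists_mul_eq_of_mem_mul hx
    rw [← mul_assoc]
    exact Submodule.mul_mem_mul (hb i hi) hj
  · intro z hz hz0
    rw [← hJ] at hz
    obtain ⟨i, hi, j, hj, rfl⟩ := exists_mul_eq_of_mem_mul hz
    obtain ⟨b, hb, hbi⟩ := h₁ i hi (left_ne_zero_of_mul hz0)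
    refine ⟨b, hb, ?_⟩
    rw [← hJ, ← mul_assoc]
    exact Submodule.mul_mem_mul hbi hj

end ValuationIdeals

theorem theorem3p17 {K : Type*} [Field K] {Γ₀ : Type*} [LinearOrderedCommGroupWithZero Γ₀]
    (v : Valuation K Γ₀) (I₁ I₂ : Submodule v.valuationSubring K)
    (hI₁ : ValuationIdeals.IsOIdeal I₁) (hI₂ : ValuationIdeals.IsOIdeal I₂) :
    (ValuationIdeals.SolvCond I₁ I₂ →
      IsGreatest (ValuationIdeals.solutions I₁ I₂) (I₂ / I₁) ∧
      (∀ a : K, ValuationIdeals.mulRing I₁ (ValuationIdeals.invRing I₂) =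
          Submodule.span (ValuationIdeals.invRing I₂) {a} →
        I₂ / I₁ = a⁻¹ • I₂) ∧
      (ValuationIdeals.IsNonprincipalOIdealOf (ValuationIdeals.invRing I₂)
          (ValuationIdeals.mulRing I₁ (ValuationIdeals.invRing I₂) : Set K) →
        I₂ / I₁ = ValuationIdeals.deepClosure (I₂ * (1 / I₁)))) ∧
    (¬ ValuationIdeals.SolvCond I₁ I₂ ↔
      ValuationIdeals.invRing I₂ < ValuationIdeals.invRing I₁ ∨
      (ValuationIdeals.invRing I₁ = ValuationIdeals.invRing I₂ ∧
        ValuationIdeals.IsNonprincipalOIdealOf (ValuationIdeals.invRing I₁) (I₁ : Set K) ∧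
        ValuationIdeals.IsPrincipalOIdealOf (ValuationIdeals.invRing I₁) (I₂ : Set K))) ∧
    (¬ ValuationIdeals.SolvCond I₁ I₂ →
      ¬ ∃ J : Submodule v.valuationSubring K, J ∈ ValuationIdeals.solutions I₁ I₂) := by
  refine ⟨fun h => ⟨ValuationIdeals.isGreatest_div hI₁ hI₂ h,
    fun a ha => ValuationIdeals.div_eq_inv_smul hI₁ ha, fun hn => ?_⟩,
    ValuationIdeals.not_solvCond_iff hI₁ hI₂,
    fun h ⟨J, hJ⟩ => h (ValuationIdeals.solvCond_of_mul_eq hI₁ hI₂ hJ.2)⟩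
  have h₁ := ValuationIdeals.hasNoGenerator_of_isNonprincipalOIdealOf_mulRing hn
  rw [ValuationIdeals.solvCond_iff hI₁ hI₂] at h
  exact ValuationIdeals.div_eq_deepClosure hI₂ h.1 h₁ (h.2 h₁)
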